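/- Let $G=\mathrm{Sym}(\mathbb N)$ be the group of all permutations of $\mathbb N$. For a set $X$ with an action of $G$, a set $D\subseteq\mathbb N$ supports $x\in X$ if $\pi\cdot x=x$ for every $\pi\in G$ that fixes every element of $D$. The least support $\mathrm{supp}(x)$ is the unique finite set that supports $x$ and has no proper subset supporting $x$, if exactly one such set exists. $X$ is a nominal set if every element of $X$ has a least support; its nominal dimension is $\sup_{x\in X}|\mathrm{supp}(x)|$, and it is orbit-finite if it has finitely many $G$-orbits. Let $A$ be an orbit-finite nominal set. A nominal DFA over $A$ consists of an orbit-finite nominal set $Q$ of states, an equivariant transition function $\delta:Q\times A\to Q$, an initial state $q_0\in Q$ whose orbit is $\{q_0\}$, and an equivariant set $F\subseteq Q$ of accepting states; it recognizes the language $L:A^*\to\{0,1\}$ with $L(w)=1$ if and only if the run on $w$ ends in $F$. A $G$-language is a function $L:A^*\to\{0,1\}$ such that $\{w : L(w)=1\}$ is invariant under the letterwise action of $G$. For natural numbers $n,k$, let $\mathcal L^{\mathrm{nom}}_A(n,k)$ be the class of $G$-languages over $A$ recognized by a nominal DFA whose state set has at most $n$ orbits and nominal dimension at most $k$. The Littlestone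 dimension $\mathrm{Ldim}(\mathcal C)$ of a class $\mathcal C$ of functions $X\to\{0,1\}$ is the maximal $d$ for which there is a complete binary tree of height $d$, with internal nodes labeled by elements of $X$, that is shattered by $\mathcal C$ (and $\infty$ if there is no maximal $d$). Shattered means that the leaves can be labeled by elements of $\mathcal C$ in such a way that, for every leaf with label $c$ and every internal node above it with label $x$, $c(x)=1$ if and only if the path from the root to the leaf goes through the left child of that node. Then for every orbit-finite nominal set $A$ of nominal dimension $p$ there is a constant $C>0$, depending only on $A$, such that for all integers $n\ge 1$ and $k\ge 1$ with $(n,k)\neq(1,1)$, $$\mathrm{Ldim}\bigl(\mathcal L^{\mathrm{nom}}_A(n,k)\bigr)\;\le\; C\,n\,k^{p}\,(\log n+k\log k).$$ In particular, this Littlestone dimension is finite. -/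

import Mathlib

/-! Nominal sets (for the equality symmetry), nominal automata, Littlestone dimension. -/

universe u v

namespace Nominal

open MulAction

/-- The group of all permutations of the atoms `ℕ`. -/
abbrev G : Type := Equiv.Perm ℕ

section Sets

variable {X : Type u} [MulAction G X]

/-- `D` is a finite support of `x` none of whose proper subsets supports `x`. Here
`Supports G D x` says that every permutation fixing each element of `D` fixes `x`. -/
def IsMinimalSupport (D : Finset ℕ) (x : X) : Prop :=
  Supports G (D : Set ℕ) x ∧ ∀ E : Set ℕ, E ⊂ (D : Set ℕ) → ¬ Supports G E x

/-- `D` is the least support of `x`: it is the one and only finite minimal support of `x`. -/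
def IsLeastSupport (D : Finset ℕ) (x : X) : Prop :=
  IsMinimalSupport D x ∧ ∀ E : Finset ℕ, IsMinimalSupport E x → E = D

end Sets

/-- A set with an action of `G` is a nominal set if each of its elements has a least support. -/
class IsNominal (X : Type u) [MulAction G X] : Prop where
  exists_isLeastSupport : ∀ x : X, ∃ D : Finset ℕ, IsLeastSupport D x

/-- The least support of an element of a nominal set. -/
noncomputable def supp {X : Type u} [MulAction G X] [IsNominal X] (x : X) : Finset ℕ :=
  Classical.choose (IsNominal.exists_isLeastSupport x)

/-- The nominal dimension: the supremum of the sizes of the least supports. -/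
noncomputable def nominalDim (X : Type u) [MulAction G X] [IsNominal X] : ℕ∞ :=
  ⨆ x : X, ((supp x).card : ℕ∞)

/-- The number of orbits (`⊤` if there are infinitely many). -/
noncomputable def numOrbits (X : Type u) [MulAction G X] : ℕ∞ :=
  ENat.card (orbitRel.Quotient G X)

/-- `X` is the union of finitely many orbits. -/
def OrbitFinite (X : Type u) [MulAction G X] : Prop :=
  Finite (orbitRel.Quotient G X)

/-- A `G`-language over `A`: a function `A^* → {0,1}` whose set of ones is equivariant, where `G`
acts on strings letter by letter. -/
def IsGLanguage {A : Type u} [MulAction G A] (L : List A → Bool) : Prop :=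
  ∀ (π : G) (w : List A), L w = true → L (w.map (fun a => π • a)) = true

/-- A nominal DFA over `A` with state set `Q`. The underlying `DFA` carries the transition function
`step`, the initial state `start` and the set `accept` of accepting states (and no finiteness
condition). -/
structure NominalDFA (A : Type u) [MulAction G A] (Q : Type v) [MulAction G Q] [IsNominal Q]
    extends DFA A Q where
  orbitFinite : OrbitFinite Q
  step_equivariant : ∀ (π : G) (q : Q) (a : A), step (π • q) (π • a) = π • step q a
  orbit_start : orbit G start = {start}
  accept_equivariant : ∀ (π : G) (q : Q), q ∈ accept → π • q ∈ accept

/-- `M` recognizes `L`: it accepts exactly the strings `w` with `L w = 1`. -/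
def NominalDFA.Recognizes {A : Type u} [MulAction G A] {Q : Type v} [MulAction G Q] [IsNominal Q]
    (M : NominalDFA A Q) (L : List A → Bool) : Prop :=
  ∀ w : List A, M.toDFA.eval w ∈ M.accept ↔ L w = true

/-- The class of `G`-languages over `A` that are recognized by some nominal DFA with at most `n`
orbits and nominal dimension at most `k`. -/
def nominalLanguages (A : Type u) [MulAction G A] (n k : ℕ) : Set (List A → Bool) :=
  {L | IsGLanguage L ∧
    ∃ (Q : Type v) (_ : MulAction G Q) (_ : IsNominal Q) (M : NominalDFA A Q),
      numOrbits Q ≤ n ∧ nominalDim Q ≤ k ∧ M.Recognizes L}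

section Littlestone

/-- A complete binary tree of height `d` with internal nodes labeled by elements of `X`. An internal
node at depth `i < d` is the sequence of the `i` turns leading to it from the root
(`true` is left, `false` is right). -/
abbrev BinaryElementTree (X : Type u) (d : ℕ) : Type u :=
  (i : Fin d) → (Fin i → Bool) → X

/-- `T` is shattered by `C`: the leaves, i.e. the sequences of `d` turns, can be labeled by elements
of `C` such that the label of a leaf `s` takes the value `1` at the label of an internal node above
`s` if and only if the path from the root to `s` turns left at that node. -/
def Shatters {X : Type u} {d : ℕ} (C : Set (X → Bool)) (T : BinaryElementTree X d) : Prop :=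
  ∃ leafLabel : (Fin d → Bool) → (X → Bool),
    (∀ s, leafLabel s ∈ C) ∧
    ∀ (s : Fin d → Bool) (i : Fin d),
      leafLabel s (T i (fun j => s (Fin.castLE i.isLt.le j))) = true ↔ s i = true

/-- The Littlestone dimension: the largest height of a binary element tree shattered by `C`,
and `⊤` if there is no largest one. -/
noncomputable def littlestoneDim {X : Type u} (C : Set (X → Bool)) : ℕ∞ :=
  ⨆ d ∈ {d : ℕ | ∃ T : BinaryElementTree X d, Shatters C T}, (d : ℕ∞)

end Littlestone

end Nominal

/-! A class shattering a tree of height d has at least 2^d members, so it suffices to count the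
languages. Orbits of states have representatives supported by the registers {0, …, k-1}, and orbits
of letters by {0, …, p-1}. By equivariance a transition is determined by the orbit of the pair
(state, letter), that is, by two representatives and a matching of letter atoms with registers:
n·r·(k+1)^p cases at most, for r orbits of letters. The target is supported by k+p atoms, so it is
one of n representatives with registers filled in one of (k+p)^k ways.

Every automaton thus has a code (`exists_code_presents`), the code determines the language
(`Presents.language_eq`), and the logarithm of the number of codes has the required order
(`log_card_code_le`). -/

namespace Nominal

open MulAction

/-! ### Extending finite partial injections to permutations -/

section Permutations

/-- A map that is injective on a finite set of atoms agrees there with a permutation. -/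
theorem exists_perm_eqOn (s : Finset ℕ) (f : ℕ → ℕ) (hf : Set.InjOn f s) :
    ∃ π : G, ∀ x ∈ s, π x = f x := by
  have h := (isMultiplyPretransitive_iff (G := G) (α := ℕ)).1
    (Equiv.Perm.isMultiplyPretransitive ℕ s.card)
  let e := s.equivFin.symm
  obtain ⟨π, hπ⟩ := h ⟨fun i => (e i : ℕ), fun i j hij => e.injective (Subtype.ext hij)⟩
    ⟨fun i => f (e i), fun i j hij =>
      e.injective (Subtype.ext (hf (e i).2 (e j).2 hij))⟩
  refine ⟨π, fun x hx => ?_⟩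
  have := DFunLike.congr_fun hπ (e.symm ⟨x, hx⟩)
  change π (e (e.symm ⟨x, hx⟩)) = f (e (e.symm ⟨x, hx⟩)) at this
  simpa only [Equiv.apply_symm_apply] using this

/-- A permutation that maps a subset of `{0, …, k - 1}` into `{0, …, m - 1}`, where `k ≤ m`, can be
changed outside of that subset so that it maps all of `{0, …, k - 1}` into `{0, …, m - 1}`. -/
theorem exists_perm_eqOn_mapsTo {k m : ℕ} (hkm : k ≤ m) (s : Finset ℕ) (hs : ∀ x ∈ s, x < k)
    (g : G) (hg : ∀ x ∈ s, g x < m) :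
    ∃ ε : G, (∀ x ∈ s, ε x = g x) ∧ ∀ x < k, ε x < m := by
  have hcard : (s.image g).card ≤ k :=
    Finset.card_image_le.trans <| by
      simpa using Finset.card_le_card (t := Finset.range k) fun x hx => by simpa using hs x hx
  -- Enlarging the image of `s` to exactly k elements below m lets the partial injection extend to a
  -- bijection from {0, …, k-1}.
  obtain ⟨t, hst, htm, htk⟩ := Finset.exists_subsuperset_card_eq (s := s.image g)
    (t := Finset.range m) (n := k) (by intro y hy; simp at hy ⊢; obtain ⟨x, hx, rfl⟩ := hy
                                       exact hg x hx) hcard (by simpa using hkm)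
  obtain ⟨e, he⟩ := Finset.exists_equiv_extend_of_card_eq (α := Fin k) (t := t) (by simp [htk])
    (s := Finset.univ.filter fun i : Fin k => (i : ℕ) ∈ s) (f := fun i => g i)
    (by
      intro y hy
      simp only [Finset.mem_image, Finset.mem_filter, Finset.mem_univ, true_and] at hy
      obtain ⟨i, hi, rfl⟩ := hy
      exact hst (Finset.mem_image_of_mem _ hi))
    (fun i _ j _ hij => Fin.ext (g.injective hij))
  obtain ⟨ε, hε⟩ := exists_perm_eqOn (Finset.range k)
    (fun x => if h : x < k then (e ⟨x, h⟩ : ℕ) else 0) (by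
      intro x hx y hy hxy
      simp only [Finset.coe_range, Set.mem_Iio] at hx hy
      simp only [hx, hy, dite_true] at hxy
      simpa using e.injective (Subtype.ext hxy))
  refine ⟨ε, fun x hx => ?_, fun x hx => ?_⟩
  · rw [hε x (by simpa using hs x hx), dif_pos (hs x hx)]
    exact he ⟨x, hs x hx⟩ (by simpa using hx)
  · rw [hε x (by simpa using hx), dif_pos hx]
    exact Finset.mem_range.1 (htm (e ⟨x, hx⟩).2)

end Permutations

/-! ### Least supports and orbit representatives -/

section Supports

variable {X : Type*} [MulAction G X]

theorem smul_eq_smul_of_supports {s : Set ℕ} {x : X} (hs : Supports G s x) {π σ : G}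
    (h : ∀ a ∈ s, π a = σ a) : π • x = σ • x := by
  have := hs (σ⁻¹ * π) fun a ha => by simp [Equiv.Perm.smul_def, h a ha]
  rwa [mul_smul, inv_smul_eq_iff] at this

theorem supports_smul {s : Set ℕ} {x : X} (hs : Supports G s x) (π : G) :
    Supports G (π '' s) (π • x) := by
  intro σ hσ
  rw [← mul_smul]
  refine smul_eq_smul_of_supports hs fun a ha => ?_
  simpa using hσ (Set.mem_image_of_mem π ha)

/-- Descending from a finite support reaches a minimal one inside it, which is `D` by uniqueness. -/
theorem IsLeastSupport.subset {D E : Finset ℕ} {x : X} (hD : IsLeastSupport D x)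
    (hE : Supports G (E : Set ℕ) x) : D ⊆ E := by
  induction E using Finset.strongInduction with
  | H E ih =>
    by_cases h : IsMinimalSupport E x
    · exact (hD.2 E h).symm.subset
    · simp only [IsMinimalSupport, hE, true_and, not_forall, not_not] at h
      obtain ⟨F, hFE, hF⟩ := h
      lift F to Finset ℕ using E.finite_toSet.subset hFE.subset
      rw [Finset.coe_ssubset] at hFE
      exact (ih F hFE hF).trans hFE.subset

variable [IsNominal X]

theorem isLeastSupport_supp (x : X) : IsLeastSupport (supp x) x :=
  Classical.choose_spec (IsNominal.exists_isLeastSupport x)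

theorem supports_supp (x : X) : Supports G (supp x : Set ℕ) x :=
  (isLeastSupport_supp x).1.1

theorem card_supp_le {m : ℕ} (h : nominalDim X ≤ m) (x : X) : (supp x).card ≤ m := by
  exact_mod_cast (le_iSup (fun x : X => ((supp x).card : ℕ∞)) x).trans h

/-- In a nominal set of dimension at most `m` each orbit has an element supported by
`{0, …, m - 1}`. -/
theorem exists_representative {m : ℕ} (h : nominalDim X ≤ m) (o : orbitRel.Quotient G X) :
    ∃ x : X, Quotient.mk _ x = o ∧ Supports G (Set.Iio m) x := by
  induction o using Quotient.inductionOn with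
  | h x =>
    let e := (supp x).equivFin
    obtain ⟨π, hπ⟩ := exists_perm_eqOn (supp x)
      (fun y => if h : y ∈ supp x then (e ⟨y, h⟩ : ℕ) else 0) (by
        intro y hy z hz hyz
        simp only [Finset.mem_coe] at hy hz
        simp only [hy, hz, dite_true] at hyz
        simpa using e.injective (Fin.ext hyz))
    refine ⟨π • x, Quotient.sound ⟨π, rfl⟩, (supports_smul (supports_supp x) π).mono ?_⟩
    rintro _ ⟨y, hy, rfl⟩
    rw [hπ y hy, dif_pos (Finset.mem_coe.1 hy)]
    exact (e ⟨y, hy⟩).2.trans_le (card_supp_le h x)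

end Supports

/-! ### Finite codes of nominal automata -/

section Coding

/-- The code of a nominal DFA with orbit representatives `q i` (`i < n`) supported by
`{0, …, k - 1}`, over an alphabet with orbit representatives `a j` supported by `{0, …, p - 1}`. -/
abbrev Code (n k p : ℕ) (J : Type*) : Type _ :=
  (Fin n → Bool) × Fin n × (Fin n × J × (Fin p → Option (Fin k)) → Fin n × (Fin k → Fin (k + p)))

/-- The renaming of the atoms of a letter that matches some of them with the registers of a state,
as prescribed by `τ`, and sends the others to atoms that are not among the registers. -/
def atomRenaming {k p : ℕ} (τ : Fin p → Option (Fin k)) (x : Fin p) : ℕ :=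
  (τ x).elim (k + x) (fun y => y)

theorem atomRenaming_lt {k p : ℕ} (τ : Fin p → Option (Fin k)) (x : Fin p) :
    atomRenaming τ x < k + p := by
  unfold atomRenaming
  cases τ x with
  | none => simp
  | some y => simpa using Nat.lt_add_right p y.2

/-- Up to a permutation fixing the registers, each permutation is a renaming on the atoms of
a letter. -/
theorem exists_atomRenaming (k p : ℕ) (ρ : G) :
    ∃ (τ : Fin p → Option (Fin k)) (θ : G),
      (∀ x < k, θ x = x) ∧ ∀ x : Fin p, (θ⁻¹ * ρ) x = atomRenaming τ x := by
  let τ : Fin p → Option (Fin k) := fun x => if h : ρ x < k then some ⟨ρ x, h⟩ else none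
  -- Registers stay fixed, and a non-register atom ρ x goes to k + x, the fresh atom that
  -- `atomRenaming` assigns to x. The inverse of a permutation extending this is the witness.
  let f : ℕ → ℕ := fun y => if y < k then y else k + ρ⁻¹ y
  obtain ⟨θ, hθ⟩ := exists_perm_eqOn (Finset.range k ∪ (Finset.range p).image ρ) f (by
    intro y _ z _ hyz
    simp only [f] at hyz
    split_ifs at hyz
    · exact hyz
    · omega
    · omega
    · exact (ρ⁻¹).injective (by omega))
  refine ⟨τ, θ⁻¹, fun x hx => ?_, fun x => ?_⟩
  · rw [Equiv.Perm.inv_eq_iff_eq, hθ x (by simp [hx])]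
    simp [f, hx]
  · rw [inv_inv, Equiv.Perm.mul_apply, hθ _ (by
      simp only [Finset.mem_union, Finset.mem_image, Finset.mem_range]
      exact Or.inr ⟨x, x.2, rfl⟩)]
    by_cases h : ρ x < k <;> simp [f, τ, atomRenaming, h]

variable {A : Type*} [MulAction G A] {J : Type*}
variable {Q : Type*} [MulAction G Q] [IsNominal Q] {n k p : ℕ}

/-- `c` codes the automaton `M` with respect to the representatives `a` of the orbits of letters
and `q` of the orbits of states. -/
structure Presents (c : Code n k p J) (M : NominalDFA A Q) (a : J → A) (q : Fin n → Q) :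
    Prop where
  supports : ∀ i, Supports G (Set.Iio k) (q i)
  start : q c.2.1 = M.start
  accept : ∀ i, c.1 i = true ↔ q i ∈ M.accept
  step : ∀ i j τ (η : G), (∀ x : Fin p, η x = atomRenaming τ x) →
    ∃ ε : G, (∀ x : Fin k, ε x = (c.2.2 (i, j, τ)).2 x) ∧
      M.step (q i) (η • a j) = ε • q (c.2.2 (i, j, τ)).1

theorem NominalDFA.smul_start (M : NominalDFA A Q) (π : G) : π • M.start = M.start := by
  have : π • M.start ∈ orbit G M.start := mem_orbit _ _
  rwa [M.orbit_start] at this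

/-- Each state supported by `{0, …, k + p - 1}` is obtained from a representative by filling its
registers with atoms below `k + p`. -/
theorem exists_registers (q : Fin n → Q) (hq : ∀ i, Supports G (Set.Iio k) (q i))
    (hsurj : ∀ s : Q, ∃ i, ∃ g : G, s = g • q i) (s : Q)
    (hs : Supports G (Set.Iio (k + p)) s) :
    ∃ r : Fin n × (Fin k → Fin (k + p)), ∃ ε : G, (∀ x : Fin k, ε x = r.2 x) ∧ s = ε • q r.1 := by
  obtain ⟨i, g, rfl⟩ := hsurj s
  have hk : supp (q i) ⊆ Finset.range k :=
    (isLeastSupport_supp (q i)).subset (by simpa using hq i)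
  -- Pulling the support of the state back along `g` shows that `g` maps the support of `q i` below
  -- k + p. Registers outside it may go anywhere, so `g` is replaced by `ε`.
  have hg : supp (q i) ⊆ (Finset.range (k + p)).image ⇑(g⁻¹) := by
    refine (isLeastSupport_supp (q i)).subset ?_
    simpa using supports_smul hs g⁻¹
  obtain ⟨ε, hε, hlt⟩ := exists_perm_eqOn_mapsTo (Nat.le_add_right k p) (supp (q i))
    (fun x hx => Finset.mem_range.1 (hk hx)) g (fun x hx => by
      obtain ⟨y, hy, rfl⟩ := Finset.mem_image.1 (hg hx)
      simpa using hy)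
  exact ⟨(i, fun x => ⟨ε x, hlt x x.2⟩), ε, fun x => rfl,
    (smul_eq_smul_of_supports (supports_supp (q i)) hε).symm⟩

/-- Every nominal DFA has a code. -/
theorem exists_code_presents (M : NominalDFA A Q) (a : J → A)
    (ha : ∀ j, Supports G (Set.Iio p) (a j)) (hn : numOrbits Q ≤ n) (hk : nominalDim Q ≤ k) :
    ∃ (c : Code n k p J) (q : Fin n → Q), Presents c M a q := by
  classical
  have : Finite (orbitRel.Quotient G Q) := M.orbitFinite
  have : Nonempty (orbitRel.Quotient G Q) := ⟨Quotient.mk _ M.start⟩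
  have hcard : Nat.card (orbitRel.Quotient G Q) ≤ n := by
    rw [numOrbits, ENat.card_eq_coe_natCard] at hn
    exact_mod_cast hn
  let e := Finite.equivFin (orbitRel.Quotient G Q)
  -- There may be fewer than n orbits; representatives then repeat.
  let o : Fin n → orbitRel.Quotient G Q := Function.invFun fun x => Fin.castLE hcard (e x)
  have ho : Function.Surjective o := Function.invFun_surjective
    ((Fin.castLE_injective hcard).comp e.injective)
  choose rep hrep hsupp using exists_representative (X := Q) hk
  let q : Fin n → Q := fun i => rep (o i)
  have hq : ∀ i, Supports G (Set.Iio k) (q i) := fun i => hsupp _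
  have hsurj : ∀ s : Q, ∃ i, ∃ g : G, s = g • q i := fun s => by
    obtain ⟨i, hi⟩ := ho (Quotient.mk _ s)
    obtain ⟨g, hg⟩ := Quotient.exact ((hrep (o i)).trans hi).symm
    exact ⟨i, g, hg.symm⟩
  obtain ⟨i₀, g, hi₀⟩ := hsurj M.start
  have hstart : q i₀ = M.start := by
    rw [← M.smul_start g⁻¹, hi₀, inv_smul_smul]
  have hstep : ∀ t : Fin n × J × (Fin p → Option (Fin k)),
      ∃ r : Fin n × (Fin k → Fin (k + p)), ∀ η : G, (∀ x : Fin p, η x = atomRenaming t.2.2 x) →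
        ∃ ε : G, (∀ x : Fin k, ε x = r.2 x) ∧ M.step (q t.1) (η • a t.2.1) = ε • q r.1 := by
    rintro ⟨i, j, τ⟩
    -- If `τ` sends two atoms to one register, no permutation realizes it, and the table entry is
    -- arbitrary.
    by_cases h : ∃ η : G, ∀ x : Fin p, η x = atomRenaming τ x
    · obtain ⟨η, hη⟩ := h
      obtain ⟨r, ε, hε, hr⟩ := exists_registers (p := p) q hq hsurj (M.step (q i) (η • a j)) (by
        intro π hπ
        rw [← M.step_equivariant, hq i π fun x hx => hπ (lt_of_lt_of_le hx (Nat.le_add_right k p)),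
          supports_smul (ha j) η π ?_]
        rintro _ ⟨x, hx, rfl⟩
        apply hπ
        rw [hη ⟨x, hx⟩]
        exact atomRenaming_lt τ _)
      refine ⟨r, fun η' hη' => ⟨ε, hε, ?_⟩⟩
      rw [← hr]
      congr 1
      exact smul_eq_smul_of_supports (ha j) fun x hx => (hη' ⟨x, hx⟩).trans (hη ⟨x, hx⟩).symm
    · exact ⟨(i, Fin.castLE (Nat.le_add_right k p)), fun η hη => (h ⟨η, hη⟩).elim⟩
  choose table htable using hstep
  exact ⟨(fun i => decide (q i ∈ M.accept), i₀, table), q,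
    { supports := hq
      start := hstart
      accept := fun i => by simp
      step := fun i j τ η hη => htable (i, j, τ) η hη }⟩

/-- As θ fixes s, the pair (π s, σ b) is the translate by πθ of (s, θ⁻¹π⁻¹σ b). With θ from
`exists_atomRenaming`, this reduces any transition to a tabulated one. -/
theorem NominalDFA.step_smul_smul (M : NominalDFA A Q) {s : Q} (hs : Supports G (Set.Iio k) s)
    {θ : G} (hθ : ∀ x < k, θ x = x) (π σ : G) (b : A) :
    M.step (π • s) (σ • b) = (π * θ) • M.step s ((θ⁻¹ * (π⁻¹ * σ)) • b) := by
  rw [← M.step_equivariant]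
  congr 1
  · rw [mul_smul, hs θ fun x hx => hθ x hx]
  · rw [← mul_smul]
    congr 1
    group

/-- Automata with the same code run in parallel. -/
theorem Presents.exists_eval_eq {Q' : Type*} [MulAction G Q'] [IsNominal Q']
    {c : Code n k p J} {a : J → A} (hsurj : ∀ b : A, ∃ j, ∃ σ : G, b = σ • a j)
    {M : NominalDFA A Q} {q : Fin n → Q} (h : Presents c M a q)
    {M' : NominalDFA A Q'} {q' : Fin n → Q'} (h' : Presents c M' a q') (w : List A) :
    ∃ (i : Fin n) (π : G), M.toDFA.eval w = π • q i ∧ M'.toDFA.eval w = π • q' i := by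
  induction w using List.reverseRecOn with
  | nil => exact ⟨c.2.1, 1, by simp [h.start], by simp [h'.start]⟩
  | append_singleton w b ih =>
    obtain ⟨i, π, hπ, hπ'⟩ := ih
    obtain ⟨j, σ, rfl⟩ := hsurj b
    obtain ⟨τ, θ, hθ, hτ⟩ := exists_atomRenaming k p (π⁻¹ * σ)
    obtain ⟨ε, hε, hs⟩ := h.step i j τ _ hτ
    obtain ⟨ε', hε', hs'⟩ := h'.step i j τ _ hτ
    -- `ε` and `ε'` agree on the registers, which support the target representatives, so `ε` serves
    -- both runs.
    refine ⟨(c.2.2 (i, j, τ)).1, π * θ * ε, ?_, ?_⟩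
    · rw [DFA.eval_append_singleton, hπ, M.step_smul_smul (h.supports i) hθ, hs, ← mul_smul]
    · rw [DFA.eval_append_singleton, hπ', M'.step_smul_smul (h'.supports i) hθ, hs', ← mul_smul, mul_smul _ ε',
        mul_smul _ ε]
      congr 1
      exact smul_eq_smul_of_supports (h'.supports _) fun x hx =>
        (hε' ⟨x, hx⟩).trans (hε ⟨x, hx⟩).symm

theorem NominalDFA.smul_mem_accept_iff (M : NominalDFA A Q) (π : G) (s : Q) :
    π • s ∈ M.accept ↔ s ∈ M.accept :=
  ⟨fun h => by simpa using M.accept_equivariant π⁻¹ _ h, M.accept_equivariant π s⟩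

/-- The code determines the recognized language. -/
theorem Presents.language_eq {Q' : Type*} [MulAction G Q'] [IsNominal Q']
    {c : Code n k p J} {a : J → A} (hsurj : ∀ b : A, ∃ j, ∃ σ : G, b = σ • a j)
    {M : NominalDFA A Q} {q : Fin n → Q} (h : Presents c M a q)
    {M' : NominalDFA A Q'} {q' : Fin n → Q'} (h' : Presents c M' a q')
    {L L' : List A → Bool} (hL : M.Recognizes L) (hL' : M'.Recognizes L') : L = L' := by
  funext w
  obtain ⟨i, π, hw, hw'⟩ := h.exists_eval_eq hsurj h' w
  rw [Bool.eq_iff_iff, ← hL w, ← hL' w, hw, hw', M.smul_mem_accept_iff, M'.smul_mem_accept_iff,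
    ← h.accept, ← h'.accept]

end Coding

/-! ### Counting codes and estimating the logarithm -/

section Counting

/-- The languages recognized by nominal DFAs of bounded size are determined by their codes. -/
theorem exists_injOn_code {A : Type u} [MulAction G A] [IsNominal A] {p : ℕ}
    (hp : nominalDim A ≤ p) (n k : ℕ) :
    ∃ f : nominalLanguages.{u, v} A n k → Code n k p (orbitRel.Quotient G A),
      Function.Injective f := by
  choose a hrep ha using exists_representative (X := A) hp
  have hsurj : ∀ b : A, ∃ j, ∃ σ : G, b = σ • a j := fun b => by
    obtain ⟨g, hg⟩ := Quotient.exact (hrep (Quotient.mk _ b)).symm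
    exact ⟨_, g, hg.symm⟩
  choose Q hQ hQ' M hn hk hM using fun L : nominalLanguages.{u, v} A n k => L.2.2
  choose c q hc using fun L => exists_code_presents (M L) a ha (hn L) (hk L)
  refine ⟨c, fun L L' hLL' => Subtype.ext ?_⟩
  have h' := hc L'
  rw [← hLL'] at h'
  exact (hc L).language_eq hsurj h' (hM L) (hM L')

/-- Two distinct branches share the node where they first part, and their leaf labels differ there.
-/
theorem two_pow_le_card_of_shatters {X : Type*} {d : ℕ} {C : Set (X → Bool)} [Finite C]
    {T : BinaryElementTree X d} (h : Shatters C T) : 2 ^ d ≤ Nat.card C := by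
  obtain ⟨leaf, hmem, hleaf⟩ := h
  have hinj : Function.Injective fun s => (⟨leaf s, hmem s⟩ : C) := by
    intro s t hst
    have hst' : leaf s = leaf t := congrArg Subtype.val hst
    have key : ∀ m (hm : m < d), s ⟨m, hm⟩ = t ⟨m, hm⟩ := by
      intro m
      induction m using Nat.strong_induction_on with
      | _ m ih =>
        intro hm
        have hnode : (fun j : Fin m => s (Fin.castLE hm.le j)) =
            fun j => t (Fin.castLE hm.le j) := funext fun j => ih j j.2 (j.2.trans hm)
        have hs := hleaf s ⟨m, hm⟩
        have ht := hleaf t ⟨m, hm⟩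
        dsimp only at hs ht
        rw [hnode, hst'] at hs
        exact Bool.eq_iff_iff.2 (hs.symm.trans ht)
    exact funext fun i => key i i.2
  have := Nat.card_le_card_of_injective _ hinj
  simpa using this

/-- The Littlestone dimension of a finite class is at most the binary logarithm of its size. -/
theorem exists_littlestoneDim_eq {X : Type*} {C : Set (X → Bool)} [Finite C] {N : ℕ}
    (hN : 0 < N) (hC : Nat.card C ≤ N) :
    ∃ d : ℕ, littlestoneDim C = d ∧ 2 ^ d ≤ N := by
  have hle : littlestoneDim C ≤ (Nat.log 2 N : ℕ) := by
    refine iSup₂_le fun d hd => ?_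
    obtain ⟨T, hT⟩ := hd
    exact_mod_cast Nat.le_log_of_pow_le one_lt_two ((two_pow_le_card_of_shatters hT).trans hC)
  obtain ⟨d, hd⟩ := ENat.ne_top_iff_exists.1 (ne_top_of_le_ne_top (ENat.natCast_ne_top _) hle)
  refine ⟨d, hd.symm, Nat.pow_le_of_le_log hN.ne' ?_⟩
  rw [← hd] at hle
  exact_mod_cast hle

theorem card_code (n k p : ℕ) (J : Type*) [Finite J] :
    Nat.card (Code n k p J) =
      2 ^ n * (n * (n * (k + p) ^ k) ^ (n * (Nat.card J * (k + 1) ^ p))) := by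
  simp only [Nat.card_prod, Nat.card_fun, Finite.card_option]
  simp

/-- At (1,1) the right side vanishes. Otherwise log n + k log k ≥ k log 2, which absorbs the terms n
log 2 and k log(1 + p). -/
theorem log_card_code_le (p r : ℕ) : ∃ C : ℝ, 0 < C ∧ ∀ n k : ℕ, 1 ≤ n → 1 ≤ k → (n, k) ≠ (1, 1) →
    Real.log ((2 ^ n * (n * (n * (k + p) ^ k) ^ (n * (r * (k + 1) ^ p))) : ℕ) : ℝ) ≤
      C * ((n : ℝ) * (k : ℝ) ^ p * (Real.log n + k * Real.log k)) := by
  have h2 : 0 < Real.log 2 := Real.log_pos one_lt_two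
  have hp : 0 ≤ Real.log (1 + p) := Real.log_nonneg (by simp)
  -- The 2 pays for the accepting bits and the initial index. The rest pays for the table, using
  -- (k+1)^p ≤ 2^p k^p and log(k+p) ≤ log k + log(1+p).
  refine ⟨2 + r * 2 ^ p * (1 + Real.log (1 + p) / Real.log 2), by positivity, ?_⟩
  intro n k hn hk hnk
  have hn' : (1 : ℝ) ≤ n := by exact_mod_cast hn
  have hk' : (1 : ℝ) ≤ k := by exact_mod_cast hk
  have hn0 : (0 : ℝ) < n := by linarith
  have hk0 : (0 : ℝ) < k := by linarith
  have hlogn : 0 ≤ Real.log n := Real.log_nonneg hn'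
  have hlogk : 0 ≤ Real.log k := Real.log_nonneg hk'
  have hklogk : 0 ≤ k * Real.log k := by positivity
  set X := Real.log n + k * Real.log k with hX
  have hkX : k * Real.log 2 ≤ X := by
    rcases Nat.lt_or_ge k 2 with hk2 | hk2
    · obtain rfl : k = 1 := by omega
      have : (2 : ℝ) ≤ n := by
        have : n ≠ 1 := by rintro rfl; exact hnk rfl
        exact_mod_cast (by omega : 2 ≤ n)
      simpa [hX] using Real.log_le_log two_pos this
    · have : Real.log 2 ≤ Real.log k := Real.log_le_log two_pos (by exact_mod_cast hk2)
      nlinarith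
  have hX2 : Real.log 2 ≤ X := le_trans (by nlinarith) hkX
  have hnkp : (n : ℝ) ≤ n * k ^ p := le_mul_of_one_le_right hn0.le (one_le_pow₀ hk')
  have hexpand : Real.log ((2 ^ n * (n * (n * (k + p) ^ k) ^ (n * (r * (k + 1) ^ p))) : ℕ) : ℝ) =
      n * Real.log 2 + (Real.log n +
        n * (r * (k + 1) ^ p) * (Real.log n + k * Real.log (k + p))) := by
    have hkp : (k + p : ℝ) ≠ 0 := by positivity
    push_cast
    rw [Real.log_mul (by positivity) (by positivity), Real.log_mul (by positivity) (by positivity),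
      Real.log_pow, Real.log_pow, Real.log_mul (by positivity) (by positivity), Real.log_pow]
    push_cast
    ring
  have hlogkp : Real.log (k + p) ≤ Real.log k + Real.log (1 + p) := by
    rw [← Real.log_mul (by positivity) (by positivity)]
    refine Real.log_le_log (by positivity) ?_
    have : (p : ℝ) ≤ k * p := le_mul_of_one_le_left (by positivity) hk'
    linarith
  have hstep : Real.log n + k * Real.log (k + p) ≤ X * (1 + Real.log (1 + p) / Real.log 2) := by
    have h1 : k * Real.log (k + p) ≤ k * (Real.log k + Real.log (1 + p)) := by gcongr
    have h3 : k * Real.log (1 + p) ≤ X * (Real.log (1 + p) / Real.log 2) := by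
      rw [mul_div_assoc', le_div_iff₀ h2]
      nlinarith
    linarith
  have hpow : ((k : ℝ) + 1) ^ p ≤ 2 ^ p * k ^ p := by
    rw [← mul_pow]
    gcongr
    linarith
  have hX0 : 0 ≤ X := by linarith
  have hA : n * Real.log 2 ≤ n * k ^ p * X := by gcongr
  have hB : Real.log n ≤ n * k ^ p * X :=
    calc Real.log n ≤ 1 * X := by linarith
      _ ≤ n * k ^ p * X := by gcongr; linarith
  have hC : n * (r * ((k : ℝ) + 1) ^ p) * (Real.log n + k * Real.log (k + p)) ≤
      n * (r * (2 ^ p * k ^ p)) * (X * (1 + Real.log (1 + p) / Real.log 2)) := by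
    have : 0 ≤ Real.log (k + p) := Real.log_nonneg (by linarith [(p.cast_nonneg : (0 : ℝ) ≤ p)])
    gcongr
  rw [hexpand]
  linarith

end Counting

end Nominal

theorem mainTheorem4 (A : Type u) [MulAction Nominal.G A] [Nominal.IsNominal A]
    (hA : Nominal.OrbitFinite A) (p : ℕ) (hp : Nominal.nominalDim A = (p : ℕ∞)) :
    ∃ C : ℝ, 0 < C ∧ ∀ n k : ℕ, 1 ≤ n → 1 ≤ k → (n, k) ≠ (1, 1) →
      ∃ d : ℕ, Nominal.littlestoneDim (Nominal.nominalLanguages.{u, v} A n k) = (d : ℕ∞) ∧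
        (d : ℝ) ≤ C * ((n : ℝ) * (k : ℝ) ^ p * (Real.log n + k * Real.log k)) := by
  have hfin : Finite (MulAction.orbitRel.Quotient Nominal.G A) := hA
  obtain ⟨C, hC, hbound⟩ :=
    Nominal.log_card_code_le p (Nat.card (MulAction.orbitRel.Quotient Nominal.G A))
  have h2 : 0 < Real.log 2 := Real.log_pos one_lt_two
  -- Dividing by log 2 passes from the natural to the binary logarithm.
  refine ⟨C / Real.log 2, by positivity, fun n k hn hk hnk => ?_⟩
  obtain ⟨f, hf⟩ := Nominal.exists_injOn_code.{u, v} (A := A) hp.le n k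
  have := Finite.of_injective f hf
  have hcard := Nat.card_le_card_of_injective f hf
  rw [Nominal.card_code] at hcard
  have hpos : 0 < 2 ^ n * (n * (n * (k + p) ^ k) ^
      (n * (Nat.card (MulAction.orbitRel.Quotient Nominal.G A) * (k + 1) ^ p))) := by
    positivity
  obtain ⟨d, hd, hle⟩ := Nominal.exists_littlestoneDim_eq hpos hcard
  refine ⟨d, hd, ?_⟩
  have hlog := Real.log_le_log (by positivity) (show ((2 ^ d : ℕ) : ℝ) ≤ _ from Nat.cast_le.2 hle)
  rw [Nat.cast_pow, Nat.cast_ofNat, Real.log_pow] at hlog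
  rw [div_mul_eq_mul_div, le_div_iff₀ h2]
  exact hlog.trans (hbound n k hn hk hnk)
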